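/- Let $n$ be a positive integer with standard prime factorization $n = p_1^{a_1} p_2^{a_2} \cdots p_r^{a_r}$, where $p_1 < p_2 < \dots < p_r$ are primes and all $a_i \ge 1$. A group $G$ of order $n$ is said to have an ordered Sylow tower if there is a series $G = R_0 \supseteq R_1 \supseteq \dots \supseteq R_r = \{e\}$ of normal subgroups of $G$ such that $|R_{i-1} : R_i| = p_i^{a_i}$ for $i = 1, \dots, r$. For a prime $p$ and $k \ge 1$ put $\psi(p^k) = (p^k - 1)(p^{k-1} - 1) \cdots (p - 1)$. Then every group of order $n$ has an ordered Sylow tower if and only if $$\gcd\bigl(p_i^{a_i} p_{i+1}^{a_{i+1}} \cdots p_r^{a_r},\ \psi(p_i^{a_i})\bigr) = 1 \quad \text{for all } 1 \le i \le r.$$ -/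

import Mathlib

/-- The multiplicative function `ψ` with `ψ(p ^ k) = (p ^ k - 1)(p ^ (k - 1) - 1) ⋯ (p - 1)`
for `p` prime (see `sylowPsi_prime_pow`). -/
def sylowPsi (n : ℕ) : ℕ :=
  n.factorization.prod fun p k => ∏ j ∈ Finset.Icc 1 k, (p ^ j - 1)

theorem sylowPsi_prime_pow {p : ℕ} (hp : p.Prime) (k : ℕ) :
    sylowPsi (p ^ k) = ∏ j ∈ Finset.Icc 1 k, (p ^ j - 1) := by
  rw [sylowPsi, hp.factorization_pow, Finsupp.prod_single_index (by simp)]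

/-- `n = p_1 ^ a_1 ⋯ p_r ^ a_r` is the standard prime factorization of `n`: the `p_i` are primes,
`p_1 < ⋯ < p_r`, and every `a_i` is positive (indices are shifted to start at `0`). -/
structure IsStandardFactorization (n : ℕ) {r : ℕ} (p a : Fin r → ℕ) : Prop where
  prime : ∀ i, (p i).Prime
  strictMono : StrictMono p
  exponent_pos : ∀ i, 0 < a i
  eq_prod : n = ∏ i, p i ^ a i

/-- `G` has an ordered Sylow tower: with `|G| = p_1 ^ a_1 ⋯ p_r ^ a_r` the standard prime
factorization (which is unique), there is a series `G = R_0 ⊇ R_1 ⊇ ⋯ ⊇ R_r = {e}` of normal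
subgroups of `G` such that `|R_{i-1} : R_i| = p_i ^ a_i` for `i = 1, …, r`. -/
def HasOrderedSylowTower (G : Type*) [Group G] : Prop :=
  ∃ (r : ℕ) (p a : Fin r → ℕ), IsStandardFactorization (Nat.card G) p a ∧
    ∃ R : Fin (r + 1) → Subgroup G,
      R 0 = ⊤ ∧ R (Fin.last r) = ⊥ ∧ (∀ i, (R i).Normal) ∧
      ∀ i : Fin r, R i.succ ≤ R i.castSucc ∧
        (R i.succ).relIndex (R i.castSucc) = p i ^ a i

open MulAction Subgroup in
/-- A `q`-group acting by automorphisms on a group of order `p ^ b` acts trivially as soon as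
`q` divides none of `p - 1, …, p ^ b - 1`. -/
theorem IsPGroup.smul_eq_self_of_card_eq_pow {Q H : Type*} [Group Q] [Group H] [Finite H]
    [MulDistribMulAction Q H] {p q b : ℕ} [hp : Fact p.Prime] [hq : Fact q.Prime] (hpq : q ≠ p)
    (hQ : IsPGroup q Q) (hH : Nat.card H = p ^ b)
    (hb : ∀ j, 1 ≤ j → j ≤ b → ¬ q ∣ p ^ j - 1) (x : Q) (h : H) : x • h = h := by
  have key := hQ.card_modEq_card_fixedPoints H
  obtain ⟨c, hc, hcard⟩ : ∃ c ≤ b, Nat.card (FixedPoints.subgroup Q H) = p ^ c :=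
    (Nat.dvd_prime_pow hp.out).mp (hH ▸ card_subgroup_dvd_card _)
  have hfix : Nat.card (fixedPoints Q H) = p ^ c := hcard
  rw [hfix, hH] at key
  have hbc : c = b := by
    by_contra hne
    have hdvd : q ∣ p ^ b - p ^ c :=
      (Nat.modEq_iff_dvd' (Nat.pow_le_pow_right hp.out.pos hc)).mp key.symm
    have hfac : p ^ b - p ^ c = p ^ c * (p ^ (b - c) - 1) := by
      rw [Nat.mul_sub, ← pow_add, mul_one, Nat.add_sub_cancel' hc]
    rw [hfac] at hdvd
    rcases hq.out.dvd_mul.mp hdvd with h1 | h1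
    · exact hpq ((Nat.prime_dvd_prime_iff_eq hq.out hp.out).mp (hq.out.dvd_of_dvd_pow h1))
    · exact hb (b - c) (by omega) (by omega) h1
  have htop : FixedPoints.subgroup Q H = ⊤ := by
    apply eq_top_of_card_eq
    rw [hcard, hbc, hH]
  have hmem : h ∈ FixedPoints.subgroup Q H := htop ▸ mem_top h
  exact hmem x

/-- The order `n` is coprime to `p ^ j - 1` at each prime other than `p`, for every `j ≥ 1` such
that `p ^ j` divides `n`. -/
def CoprimeToPowSubOne (p n : ℕ) : Prop :=
  ∀ q, q.Prime → q ∣ n → q ≠ p → ∀ j, 1 ≤ j → p ^ j ∣ n → ¬ q ∣ p ^ j - 1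

theorem CoprimeToPowSubOne.of_dvd {p m n : ℕ} (h : CoprimeToPowSubOne p n) (hmn : m ∣ n) :
    CoprimeToPowSubOne p m :=
  fun q hq hqm hqp j hj hjm => h q hq (hqm.trans hmn) hqp j hj (hjm.trans hmn)

section Fusion

variable {G : Type*} [Group G] [Finite G] {p : ℕ} [hp : Fact p.Prime]

open Subgroup
open scoped commutatorElement

theorem CoprimeToPowSubOne.le_centralizer (hG : CoprimeToPowSubOne p (Nat.card G))
    {D : Subgroup G} [D.Normal] (hD : IsPGroup p D) {q : ℕ} [hq : Fact q.Prime] (hqp : q ≠ p)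
    {Q : Subgroup G} (hQ : IsPGroup q Q) : Q ≤ centralizer (D : Set G) := by
  by_cases hqG : q ∣ Nat.card Q
  · obtain ⟨b, hb⟩ := IsPGroup.iff_card.mp hD
    let _ : MulDistribMulAction Q D :=
      MulDistribMulAction.compHom D ((MulAut.conjNormal (H := D)).comp Q.subtype)
    intro x hx
    rw [mem_centralizer_iff]
    intro d hd
    have := IsPGroup.smul_eq_self_of_card_eq_pow hqp hQ hb
      (fun j hj hjb => hG q hq.out (hqG.trans (card_subgroup_dvd_card Q)) hqp j hj
        (((pow_dvd_pow p hjb).trans hb.symm.dvd).trans (card_subgroup_dvd_card D)))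
      ⟨x, hx⟩ ⟨d, hd⟩
    have h2 : x * d * x⁻¹ = d := congrArg Subtype.val this
    exact (mul_inv_eq_iff_eq_mul.mp h2).symm
  · obtain ⟨k, hk⟩ := IsPGroup.iff_card.mp hQ
    have : k = 0 := by
      by_contra hk0
      exact hqG (hk ▸ dvd_pow_self q hk0)
    rw [this, pow_zero] at hk
    rw [card_eq_one.mp hk]
    exact bot_le

theorem CoprimeToPowSubOne.centralizer_sup_sylow (hG : CoprimeToPowSubOne p (Nat.card G))
    {D : Subgroup G} [D.Normal] (hD : IsPGroup p D) (S : Sylow p G) :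
    centralizer (D : Set G) ⊔ S = ⊤ := by
  rw [← index_eq_one]
  by_contra hne
  obtain ⟨q, hq, hqi⟩ := Nat.exists_prime_and_dvd hne
  have := Fact.mk hq
  by_cases hqp : q = p
  · subst hqp
    exact S.not_dvd_index (hqi.trans (index_dvd_of_le le_sup_right))
  · let Q : Sylow q G := default
    exact Q.not_dvd_index
      (hqi.trans (index_dvd_of_le ((hG.le_centralizer hD hqp Q.isPGroup').trans le_sup_left)))

theorem CoprimeToPowSubOne.exists_centralizer_smul_eq (hG : CoprimeToPowSubOne p (Nat.card G))
    {D : Subgroup G} [D.Normal] (hD : IsPGroup p D) (S T : Sylow p G) :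
    ∃ c ∈ centralizer (D : Set G), c • S = T := by
  obtain ⟨g, hg⟩ := MulAction.exists_smul_eq G S T
  have hmem : g ∈ centralizer (D : Set G) ⊔ S := hG.centralizer_sup_sylow hD S ▸ mem_top g
  obtain ⟨c, hc, s, hs, rfl⟩ := mem_sup_of_normal_left.mp hmem
  refine ⟨c, hc, ?_⟩
  rw [mul_smul] at hg
  rwa [Sylow.smul_eq_iff_mem_normalizer.mpr (le_normalizer hs)] at hg

theorem CoprimeToPowSubOne.exists_sylow_le (hG : CoprimeToPowSubOne p (Nat.card G))
    {D A B : Subgroup G} (hD : IsPGroup p D) (hA : IsPGroup p A) (hB : IsPGroup p B)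
    (hAD : A ≤ normalizer (D : Set G)) (hBD : B ≤ normalizer (D : Set G)) :
    ∃ c ∈ centralizer (D : Set G), ∃ R : Sylow p G, A ≤ R ∧ B ≤ (c • R : Sylow p G) := by
  set N := normalizer (D : Set G)
  have hN := hG.of_dvd (card_subgroup_dvd_card N)
  have hsub : ∀ {K : Subgroup G}, IsPGroup p K → IsPGroup p (K.subgroupOf N) := fun hK =>
    hK.comap_of_injective N.subtype N.subtype_injective
  obtain ⟨S, hS⟩ := (hsub hA).exists_le_sylow
  obtain ⟨T, hT⟩ := (hsub hB).exists_le_sylow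
  obtain ⟨c, hc, hcS⟩ := hN.exists_centralizer_smul_eq (hsub hD) S T
  obtain ⟨R, hR⟩ := (S.isPGroup'.map N.subtype).exists_le_sylow
  refine ⟨c, ?_, R, fun a ha => hR ⟨⟨a, hAD ha⟩, hS ha, rfl⟩, fun b hb => ?_⟩
  · rw [mem_centralizer_iff]
    intro d hd
    exact congrArg Subtype.val
      (mem_centralizer_iff.mp hc ⟨d, le_normalizer hd⟩ (mem_subgroupOf.mpr hd))
  · have hbT : (⟨b, hBD hb⟩ : N) ∈ (c • S : Sylow p N) := hcS ▸ hT (mem_subgroupOf.mpr hb)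
    obtain ⟨s, hs, hsb⟩ := hbT
    refine ⟨s, hR ⟨s, hs, rfl⟩, ?_⟩
    exact congrArg Subtype.val hsb

theorem IsPGroup.lt_inf_normalizer {D P : Subgroup G} (hP : IsPGroup p P) (hDP : D < P) :
    D < P ⊓ normalizer (D : Set G) := by
  have := hP.isNilpotent
  have h := Group.normalizerCondition_of_isNilpotent (G := P) (D.subgroupOf P)
    (lt_top_iff_ne_top.mpr fun h => hDP.not_ge (subgroupOf_eq_top.mp h))
  obtain ⟨x, hx, hxD⟩ := SetLike.exists_of_lt h
  refine lt_of_le_of_ne (le_inf hDP.le le_normalizer) fun heq => hxD ?_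
  rw [mem_subgroupOf, heq]
  refine ⟨x.2, ?_⟩
  rw [← subgroupOf_normalizer_eq hDP.le] at hx
  exact hx

/-- Two Sylow `p`-subgroups are conjugate under the centralizer of their intersection. -/
theorem CoprimeToPowSubOne.exists_centralizer_inf_smul_eq
    (hG : CoprimeToPowSubOne p (Nat.card G)) (P Q : Sylow p G) :
    ∃ c ∈ centralizer ((P ⊓ Q : Subgroup G) : Set G), c • P = Q := by
  induction hk : Nat.card P - Nat.card (P ⊓ Q : Subgroup G) using Nat.strong_induction_on
    generalizing P Q with
  | _ k ih =>
  subst hk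
  by_cases hPQ : (P : Subgroup G) ≤ Q
  · refine ⟨1, one_mem _, ?_⟩
    rw [one_smul]
    exact Sylow.ext (P.is_maximal' Q.isPGroup' hPQ).symm
  have hQP : ¬ (Q : Subgroup G) ≤ P := fun h =>
    hPQ (Q.is_maximal' P.isPGroup' h).le
  set D : Subgroup G := P ⊓ Q with hD
  have hDP : D < P := lt_of_le_not_ge inf_le_left fun h => hPQ (h.trans inf_le_right)
  have hDQ : D < Q := lt_of_le_not_ge inf_le_right fun h => hQP (h.trans inf_le_left)
  have hA := P.isPGroup'.lt_inf_normalizer hDP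
  have hB := Q.isPGroup'.lt_inf_normalizer hDQ
  obtain ⟨c, hc, R, hAR, hBR⟩ := hG.exists_sylow_le (P.isPGroup'.to_le hDP.le)
    (P.isPGroup'.to_le inf_le_left) (Q.isPGroup'.to_le inf_le_left)
    (A := P ⊓ normalizer (D : Set G)) (B := Q ⊓ normalizer (D : Set G))
    inf_le_right inf_le_right
  have hPR : D < (P : Subgroup G) ⊓ R := hA.trans_le (le_inf inf_le_left hAR)
  have hRQ : D < ((c • R : Sylow p G) : Subgroup G) ⊓ Q := hB.trans_le (le_inf hBR inf_le_left)
  have hcard : ∀ S : Sylow p G, Nat.card S = Nat.card P := fun S =>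
    Nat.card_congr (S.equiv P).toEquiv
  have hlt : ∀ {E : Subgroup G}, D < E → Nat.card D < Nat.card E := fun h =>
    Set.ncard_lt_ncard (SetLike.coe_ssubset_coe.mpr h)
  obtain ⟨x, hx, hxP⟩ := ih _ (by have := hlt hPR; have := hlt hDP; omega) P R rfl
  obtain ⟨y, hy, hyR⟩ := ih _
    (by rw [hcard]; have := hlt hRQ; have := hlt hDP; omega) (c • R) Q rfl
  refine ⟨y * c * x, mul_mem (mul_mem ?_ hc) ?_, ?_⟩
  · exact centralizer_le hRQ.le hy
  · exact centralizer_le hPR.le hx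
  · rw [mul_smul, mul_smul, hxP, hyR]

theorem CoprimeToPowSubOne.focalSubgroupOf_le_commutator
    (hG : CoprimeToPowSubOne p (Nat.card G)) (P : Sylow p G) :
    (P : Subgroup G).focalSubgroupOf ≤ _root_.commutator P := by
  rw [focalSubgroupOf_eq_closure, closure_le]
  rintro g ⟨x, hx, u, hg⟩
  have hy : u * x * u⁻¹ ∈ P := by
    have h1 : u * x * u⁻¹ = (g : G)⁻¹ * x := by
      rw [hg, commutatorElement_def]; group
    rw [h1]
    exact mul_mem (inv_mem g.2) hx
  obtain ⟨c, hc, hcP⟩ := hG.exists_centralizer_inf_smul_eq (u • P) P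
  rw [smul_smul, Sylow.smul_eq_iff_mem_normalizer] at hcP
  have hcy := mem_centralizer_iff.mp hc (u * x * u⁻¹) ⟨⟨x, hx, rfl⟩, hy⟩
  set N := normalizer (P : Set G)
  have hPN : (P : Subgroup G) ≤ N := le_normalizer
  have hN := hG.of_dvd (card_subgroup_dvd_card N)
  have hn : ((P : Subgroup G).subgroupOf N).Normal := normal_in_normalizer
  have htop := hN.centralizer_sup_sylow (D := (P : Subgroup G).subgroupOf N)
    (P.isPGroup'.comap_of_injective N.subtype N.subtype_injective) (P.subtype hPN)
  rw [sup_comm] at htop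
  obtain ⟨v, hv, d, hd, hvd⟩ := mem_sup_of_normal_right.mp (htop ▸ mem_top (⟨c * u, hcP⟩ : N))
  have hvd' : (v : G) * d = c * u := congrArg Subtype.val hvd
  have hdx : x * (d : G) = d * x := congrArg Subtype.val
    (mem_centralizer_iff.mp hd ⟨x, hPN hx⟩ (mem_subgroupOf.mpr hx))
  have hconj : u * x * u⁻¹ = v * x * (v : G)⁻¹ := by
    calc u * x * u⁻¹ = c * (u * x * u⁻¹) * c⁻¹ := by rw [← hcy]; group
      _ = (c * u) * x * (c * u)⁻¹ := by group
      _ = v * (d * x) * (d : G)⁻¹ * (v : G)⁻¹ := by rw [← hvd']; group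
      _ = v * x * (v : G)⁻¹ := by rw [← hdx]; group
  have hgv : g = ⁅(⟨x, hx⟩ : P), (⟨v, hv⟩ : P)⁆ := by
    apply Subtype.ext
    rw [hg]
    calc ⁅x, u⁆ = x * (u * x * u⁻¹)⁻¹ := by rw [commutatorElement_def]; group
      _ = ⁅x, (v : G)⁆ := by rw [hconj, commutatorElement_def]; group
  rw [hgv]
  exact commutator_mem_commutator (mem_top _) (mem_top _)

end Fusion

/-- A subgroup whose order divides that of a normal Hall subgroup is contained in it. -/
theorem Subgroup.le_of_card_dvd_of_coprime_index {G : Type*} [Group G] [Finite G]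
    {M N : Subgroup G} [N.Normal] (hN : (Nat.card N).Coprime N.index)
    (hM : Nat.card M ∣ Nat.card N) : M ≤ N := by
  intro x hx
  rw [← QuotientGroup.eq_one_iff, ← orderOf_eq_one_iff]
  refine Nat.eq_one_of_dvd_coprimes hN ?_ ?_
  · exact (orderOf_map_dvd (QuotientGroup.mk' N) x).trans ((M.orderOf_dvd_natCard hx).trans hM)
  · exact _root_.orderOf_dvd_natCard (QuotientGroup.mk' N x)

theorem Subgroup.characteristic_of_coprime_index {G : Type*} [Group G] [Finite G]
    {N : Subgroup G} [N.Normal] (hN : (Nat.card N).Coprime N.index) : N.Characteristic := by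
  rw [characteristic_iff_map_le]
  intro φ
  exact le_of_card_dvd_of_coprime_index hN (card_map_dvd N φ.toMonoidHom)

open Subgroup in
theorem CoprimeToPowSubOne.exists_normal_complement {p : ℕ} [hp : Fact p.Prime] {G : Type*}
    [Group G] [Finite G] (hG : CoprimeToPowSubOne p (Nat.card G)) :
    ∃ N : Subgroup G, N.Normal ∧ ¬ p ∣ Nat.card N ∧ ∃ k, N.index = p ^ k := by
  induction hn : Nat.card G using Nat.strong_induction_on generalizing G with
  | _ n ih =>
  subst hn
  by_cases hpG : p ∣ Nat.card G
  swap
  · exact ⟨⊤, inferInstance, by rwa [card_top], 0, by simp⟩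
  let P : Sylow p G := default
  have hPbot : Nontrivial P := (nontrivial_iff_ne_bot _).mpr (P.ne_bot_of_dvd_card hpG)
  have hPnil := P.isPGroup'.isNilpotent
  have hfoc : (P : Subgroup G).focalSubgroupOf ≠ ⊤ := fun h => by
    have := hG.focalSubgroupOf_le_commutator P
    rw [h] at this
    exact (Group.IsSolvable.commutator_lt_top_of_nontrivial P).ne (top_le_iff.mp this)
  set K := (P : Subgroup G).transferFocal.ker
  have hKidx : K.index = (P : Subgroup G).focalSubgroupOf.index := by
    rw [index_ker, index, MonoidHom.range_eq_top.mpr (transferFocal_surjective P), card_top]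
  obtain ⟨m, hm⟩ := P.isPGroup'.index (P : Subgroup G).focalSubgroupOf
  have hK1 : K.index ≠ 1 := by rwa [hKidx, Ne, index_eq_one]
  have hKlt : Nat.card K < Nat.card G := by
    rw [← K.card_mul_index]
    have : K.index ≠ 0 := K.index_ne_zero_of_finite
    exact lt_mul_of_one_lt_right Nat.card_pos (by omega)
  obtain ⟨N, hNn, hNp, k, hk⟩ := ih _ hKlt (hG.of_dvd (card_subgroup_dvd_card K)) rfl
  have hNc : N.Characteristic := by
    apply characteristic_of_coprime_index
    rw [hk]
    exact (((Nat.Prime.coprime_iff_not_dvd hp.out).mpr hNp).symm).pow_right k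
  refine ⟨N.map K.subtype, inferInstance, ?_, k + m, ?_⟩
  · rwa [card_map_of_injective K.subtype_injective]
  · rw [index_map_subtype, hk, hKidx, hm, pow_add]

theorem sylowPsi_factor_dvd {p : ℕ} (hp : p.Prime) {j k : ℕ} (hj : 1 ≤ j) (hjk : j ≤ k) :
    p ^ j - 1 ∣ sylowPsi (p ^ k) := by
  rw [sylowPsi_prime_pow hp]
  exact Finset.dvd_prod_of_mem _ (Finset.mem_Icc.mpr ⟨hj, hjk⟩)

theorem Nat.Prime.exists_dvd_of_dvd_sylowPsi {p q k : ℕ} (hq : q.Prime) (hp : p.Prime)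
    (h : q ∣ sylowPsi (p ^ k)) : ∃ j, 1 ≤ j ∧ j ≤ k ∧ q ∣ p ^ j - 1 := by
  rw [sylowPsi_prime_pow hp, hq.prime.dvd_finsetProd_iff] at h
  obtain ⟨j, hj, hd⟩ := h
  exact ⟨j, (Finset.mem_Icc.mp hj).1, (Finset.mem_Icc.mp hj).2, hd⟩

namespace IsStandardFactorization

variable {n r : ℕ} {p a : Fin r → ℕ}

/-- The part of `∏ j, p j ^ a j` with indices at least `k`. -/
def tail {r : ℕ} (p a : Fin r → ℕ) (k : ℕ) : ℕ :=
  ∏ j ∈ Finset.univ.filter (fun j : Fin r => k ≤ j), p j ^ a j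

theorem tail_zero (h : IsStandardFactorization n p a) : tail p a 0 = n := by
  simp [tail, h.eq_prod]

theorem tail_last : tail p a r = 1 := by
  rw [tail, Finset.filter_false_of_mem fun j _ => by omega, Finset.prod_empty]

theorem tail_coe (i : Fin r) : tail p a i = ∏ j ∈ Finset.Ici i, p j ^ a j := by
  refine Finset.prod_congr (Finset.ext fun j => ?_) fun _ _ => rfl
  rw [Finset.mem_filter, Finset.mem_Ici, Fin.le_def]
  exact and_iff_right (Finset.mem_univ j)

theorem tail_eq_mul (i : Fin r) : tail p a i = p i ^ a i * tail p a (i + 1) := by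
  have h1 : Finset.univ.filter (fun j : Fin r => (i : ℕ) ≤ j) =
      insert i (Finset.univ.filter (fun j : Fin r => (i : ℕ) + 1 ≤ j)) := by
    ext j
    simp only [Finset.mem_filter, Finset.mem_univ, true_and, Finset.mem_insert, Fin.ext_iff]
    omega
  rw [tail, h1, Finset.prod_insert (by simp), tail]

theorem prod_coprime (h : IsStandardFactorization n p a) {s t : Finset (Fin r)}
    (hst : Disjoint s t) : (∏ j ∈ s, p j ^ a j).Coprime (∏ j ∈ t, p j ^ a j) := by
  refine Nat.Coprime.prod_left fun i hi => Nat.Coprime.prod_right fun j hj => ?_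
  refine Nat.coprime_pow_primes _ _ (h.prime i) (h.prime j) (h.strictMono.injective.ne ?_)
  exact fun hij => Finset.disjoint_left.mp hst hi (hij ▸ hj)

theorem exists_head (h : IsStandardFactorization n p a) (k : ℕ) :
    ∃ m, tail p a k * m = n ∧ (tail p a k).Coprime m := by
  refine ⟨∏ j ∈ Finset.univ.filter (fun j : Fin r => ¬ k ≤ j), p j ^ a j, ?_, ?_⟩
  · rw [tail, Finset.prod_filter_mul_prod_filter_not, h.eq_prod]
  · exact h.prod_coprime (Finset.disjoint_filter_filter_not _ _ _)

theorem coprime_tail_succ (h : IsStandardFactorization n p a) (i : Fin r) :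
    (p i).Coprime (tail p a (i + 1)) := by
  refine Nat.Coprime.prod_right fun j hj => ?_
  refine Nat.Coprime.pow_right _ ((Nat.coprime_primes (h.prime i) (h.prime j)).mpr
    (h.strictMono.injective.ne fun hij => ?_))
  have := (Finset.mem_filter.mp hj).2
  rw [← hij] at this
  omega

theorem coprimeToPowSubOne_tail (h : IsStandardFactorization n p a) {i : Fin r}
    (hi : Nat.gcd (∏ j ∈ Finset.Ici i, p j ^ a j) (sylowPsi (p i ^ a i)) = 1) :
    CoprimeToPowSubOne (p i) (tail p a i) := by
  intro q hq hqt _ j hj hjt hqj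
  have hja : j ≤ a i := by
    rw [tail_eq_mul] at hjt
    exact (Nat.pow_dvd_pow_iff_le_right (h.prime i).one_lt).mp
      ((Nat.Coprime.pow_left j (h.coprime_tail_succ i)).dvd_of_dvd_mul_right hjt)
  rw [tail_coe] at hqt
  exact hq.one_lt.ne' (Nat.dvd_one.mp
    (hi ▸ Nat.dvd_gcd hqt (hqj.trans (sylowPsi_factor_dvd (h.prime i) hj hja))))

open Subgroup in
theorem exists_normal_card_tail (h : IsStandardFactorization n p a)
    (hgcd : ∀ i : Fin r, Nat.gcd (∏ j ∈ Finset.Ici i, p j ^ a j) (sylowPsi (p i ^ a i)) = 1)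
    {G : Type*} [Group G] [Finite G] (hG : Nat.card G = n) (k : ℕ) (hk : k ≤ r) :
    ∃ N : Subgroup G, N.Normal ∧ Nat.card N = tail p a k := by
  induction k with
  | zero => exact ⟨⊤, inferInstance, by rw [card_top, hG, h.tail_zero]⟩
  | succ k ih =>
    obtain ⟨N, hN, hcard⟩ := ih (by omega)
    let i : Fin r := ⟨k, hk⟩
    have := Fact.mk (h.prime i)
    have hcop : CoprimeToPowSubOne (p i) (Nat.card N) :=
      hcard ▸ h.coprimeToPowSubOne_tail (hgcd i)
    obtain ⟨M, hM, hpM, e, he⟩ := hcop.exists_normal_complement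
    have hpM' : (p i).Coprime (Nat.card M) := ((h.prime i).coprime_iff_not_dvd).mpr hpM
    have hMc : M.Characteristic := by
      apply characteristic_of_coprime_index
      rw [he]
      exact hpM'.symm.pow_right e
    refine ⟨M.map N.subtype, inferInstance, ?_⟩
    rw [card_map_of_injective N.subtype_injective]
    have hmul : Nat.card M * p i ^ e = p i ^ a i * tail p a (k + 1) := by
      rw [← he, card_mul_index, hcard]
      exact tail_eq_mul i
    apply Nat.dvd_antisymm
    · exact (hpM'.symm.pow_right (a i)).dvd_of_dvd_mul_left (hmul ▸ dvd_mul_right _ _)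
    · exact ((h.coprime_tail_succ i).symm.pow_right e).dvd_of_dvd_mul_right
        (hmul.symm ▸ dvd_mul_left _ _)

open Subgroup in
theorem hasOrderedSylowTower (h : IsStandardFactorization n p a)
    (hgcd : ∀ i : Fin r, Nat.gcd (∏ j ∈ Finset.Ici i, p j ^ a j) (sylowPsi (p i ^ a i)) = 1)
    {G : Type*} [Group G] (hG : Nat.card G = n) : HasOrderedSylowTower G := by
  have hn : n ≠ 0 := by
    rw [h.eq_prod]
    exact Finset.prod_ne_zero_iff.mpr fun i _ => pow_ne_zero _ (h.prime i).ne_zero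
  have : Finite G := Nat.finite_of_card_ne_zero (hG ▸ hn)
  choose R hR hcard using fun k : Fin (r + 1) =>
    h.exists_normal_card_tail hgcd hG k (Nat.lt_succ_iff.mp k.2)
  have hle : ∀ i : Fin r, R i.succ ≤ R i.castSucc := by
    intro i
    apply le_of_card_dvd_of_coprime_index
    · obtain ⟨m, hm, hc⟩ := h.exists_head i.castSucc
      have : (R i.castSucc).index = m := by
        have h1 := (R i.castSucc).card_mul_index
        rw [hG, ← hm, hcard] at h1
        exact Nat.eq_of_mul_eq_mul_left (hcard i.castSucc ▸ Nat.card_pos) h1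
      rwa [this, hcard]
    · rw [hcard, hcard, Fin.val_castSucc, tail_eq_mul i, Fin.val_succ]
      exact dvd_mul_left _ _
  refine ⟨r, p, a, hG ▸ h, R, ?_, ?_, hR, fun i => ⟨hle i, ?_⟩⟩
  · apply eq_top_of_card_eq
    rw [hcard, hG]
    exact h.tail_zero
  · rw [← card_eq_one, hcard]
    exact tail_last
  · have h1 := relIndex_mul_relIndex ⊥ _ _ bot_le (hle i)
    rw [relIndex_bot_left, relIndex_bot_left, mul_comm, hcard, hcard, Fin.val_castSucc, tail_eq_mul i, Fin.val_succ] at h1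
    refine Nat.eq_of_mul_eq_mul_right ?_ h1
    have := hcard i.succ
    rw [Fin.val_succ] at this
    exact this ▸ Nat.card_pos

end IsStandardFactorization

theorem Subgroup.mem_of_pow_eq_one_of_relIndex_eq {G : Type*} [Group G] {A B : Subgroup G}
    [A.Normal] {m k : ℕ} (hidx : A.relIndex B = k) (hmk : m.Coprime k) {y : G} (hy : y ∈ B)
    (hym : y ^ m = 1) : y ∈ A := by
  have h1 : y ^ k ∈ A := hidx ▸ A.pow_relIndex_mem hy
  rw [← QuotientGroup.eq_one_iff] at h1 ⊢
  rw [← orderOf_eq_one_iff]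
  refine Nat.eq_one_of_dvd_coprimes hmk (orderOf_dvd_of_pow_eq_one ?_)
    (orderOf_dvd_of_pow_eq_one ?_)
  · rw [← QuotientGroup.mk_pow, hym, QuotientGroup.mk_one]
  · rw [← QuotientGroup.mk_pow, h1]

/-- In a group with an ordered Sylow tower, if `x` has order dividing a prime `q` and `⁅v, x⁆` has
order dividing a smaller prime `s`, then `⁅v, x⁆ = 1`. -/
theorem HasOrderedSylowTower.conj_mul_inv_eq_one {G : Type*} [Group G]
    (hG : HasOrderedSylowTower G) {s q : ℕ} (hs : s.Prime) (hq : q.Prime) (hsq : s < q) {v x : G}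
    (hx : x ^ q = 1) (hc : (v * x * v⁻¹ * x⁻¹) ^ s = 1) : v * x * v⁻¹ * x⁻¹ = 1 := by
  obtain ⟨r, p, a, h, R, htop, hbot, hn, hR⟩ := hG
  have hcop : ∀ {t : ℕ} (i : Fin r), t.Prime → p i ≠ t → t.Coprime (p i ^ a i) := fun i ht hit =>
    ((Nat.coprime_primes ht (h.prime i)).mpr hit.symm).pow_right _
  have key : ∀ k : Fin (r + 1), v * x * v⁻¹ * x⁻¹ ∈ R k ∧
      ((∀ j : Fin r, j.castSucc < k → p j ≤ s) → x ∈ R k) := by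
    intro k
    induction k using Fin.induction with
    | zero => simp [htop]
    | succ i ih =>
      obtain ⟨hci, hxi⟩ := ih
      have hxs : (∀ j : Fin r, j.castSucc < i.succ → p j ≤ s) → x ∈ R i.succ := fun hj =>
        Subgroup.mem_of_pow_eq_one_of_relIndex_eq (hR i).2
          (hcop i hq ((hj i i.castSucc_lt_succ).trans_lt hsq).ne)
          (hxi fun j hji => hj j (hji.trans i.castSucc_lt_succ)) hx
      refine ⟨?_, hxs⟩
      by_cases his : p i = s
      · have hxm : x ∈ R i.succ := hxs fun j hj => by
          rw [← his]
          exact h.strictMono.monotone (Fin.castSucc_lt_succ_iff.mp hj)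
        exact mul_mem ((hn i.succ).conj_mem x hxm v) (inv_mem hxm)
      · exact Subgroup.mem_of_pow_eq_one_of_relIndex_eq (hR i).2 (hcop i hs his) hci hc
  have := (key (Fin.last r)).1
  rwa [hbot, Subgroup.mem_bot] at this

/-- If `q` divides `s ^ j - 1`, there is a group of order `s ^ j * q` with a normal `s`-subgroup
on which an element of order `q` acts nontrivially. -/
theorem exists_group_card_eq_pow_mul {s q j : ℕ} (hs : s.Prime) (hq : q.Prime) (hj : 1 ≤ j)
    (hdvd : q ∣ s ^ j - 1) :
    ∃ (A : Type) (_ : Group A), Nat.card A = s ^ j * q ∧ ∃ v x : A, x ^ q = 1 ∧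
      (v * x * v⁻¹ * x⁻¹) ^ s = 1 ∧ v * x * v⁻¹ * x⁻¹ ≠ 1 := by
  have := Fact.mk hs
  have := Fact.mk hq
  let F := GaloisField s j
  have hF : Nat.card F = s ^ j := GaloisField.card s j (by omega)
  have : Finite F := Nat.finite_of_card_ne_zero (hF ▸ pow_ne_zero _ hs.ne_zero)
  obtain ⟨u, hu⟩ := exists_prime_orderOf_dvd_card' (G := Fˣ) q
    (by rwa [Nat.card_units, hF])
  let φ : Subgroup.zpowers u →* MulAut (Multiplicative F) :=
    { toFun := fun w => AddEquiv.toMultiplicative (DistribMulAction.toAddEquiv F (w : Fˣ))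
      map_one' := by ext; simp
      map_mul' := fun w₁ w₂ => by ext; simp [mul_smul] }
  have hφ : ∀ w y, φ w (Multiplicative.ofAdd y) = Multiplicative.ofAdd (((w : Fˣ) : F) * y) :=
    fun w y => rfl
  let u' : Subgroup.zpowers u := ⟨u, Subgroup.mem_zpowers u⟩
  let y : Multiplicative F := Multiplicative.ofAdd (1 : F)
  have hcomm : (SemidirectProduct.inl y * SemidirectProduct.inr u' * (SemidirectProduct.inl y)⁻¹ *
      (SemidirectProduct.inr u')⁻¹ : Multiplicative F ⋊[φ] Subgroup.zpowers u) =
      SemidirectProduct.inl (y * (φ u' y)⁻¹) := by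
    rw [map_mul, map_inv, SemidirectProduct.inl_aut, map_inv]
    group
  refine ⟨Multiplicative F ⋊[φ] Subgroup.zpowers u, inferInstance, ?_,
    SemidirectProduct.inl y, SemidirectProduct.inr u', ?_, ?_, ?_⟩
  · rw [SemidirectProduct.card, Nat.card_zpowers, hu]
    exact congrArg (· * q) hF
  · rw [← map_pow]
    have : u' ^ q = 1 := Subtype.ext (by
      rw [← hu]
      exact pow_orderOf_eq_one u)
    rw [this, map_one]
  · rw [hcomm, ← map_pow]
    have : ∀ z : Multiplicative F, z ^ s = 1 := fun z => by
      change Multiplicative.ofAdd (s • z.toAdd) = 1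
      rw [nsmul_eq_mul, CharP.cast_eq_zero, zero_mul, ofAdd_zero]
    rw [this, map_one]
  · rw [hcomm, Ne, ← map_one (SemidirectProduct.inl (φ := φ)), SemidirectProduct.inl_inj,
      mul_inv_eq_one, hφ]
    intro h1
    have h2 : (1 : F) = (u : F) * 1 := Multiplicative.ofAdd.injective h1
    have h3 : u = 1 := Units.ext (by rw [mul_one] at h2; exact h2.symm)
    rw [h3, orderOf_one] at hu
    exact hq.one_lt.ne hu

theorem mainTheorem5 (n r : ℕ) (p a : Fin r → ℕ) (h : IsStandardFactorization n p a) :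
    (∀ (G : Type*) [Group G], Nat.card G = n → HasOrderedSylowTower G) ↔
      ∀ i : Fin r, Nat.gcd (∏ j ∈ Finset.Ici i, p j ^ a j) (sylowPsi (p i ^ a i)) = 1 := by
  refine ⟨fun hall i => ?_, fun hgcd G _ hG => h.hasOrderedSylowTower hgcd hG⟩
  by_contra hne
  obtain ⟨q, hq, hqg⟩ := Nat.exists_prime_and_dvd hne
  obtain ⟨k, hk, hqk⟩ :=
    (hq.prime.dvd_finsetProd_iff _).mp (hqg.trans (Nat.gcd_dvd_left _ _))
  obtain rfl : q = p k :=
    (Nat.prime_dvd_prime_iff_eq hq (h.prime k)).mp (hq.dvd_of_dvd_pow hqk)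
  obtain ⟨j, hj, hja, hqj⟩ :=
    hq.exists_dvd_of_dvd_sylowPsi (h.prime i) (hqg.trans (Nat.gcd_dvd_right _ _))
  have hik : i ≠ k := by
    rintro rfl
    have h1 := Nat.pow_pos (n := j) (h.prime i).pos
    have h2 := (Nat.dvd_sub_iff_right (by omega) (dvd_pow_self (p i) (by omega : j ≠ 0))).mp hqj
    exact (h.prime i).one_lt.ne' (Nat.dvd_one.mp h2)
  have hlt : p i < p k :=
    h.strictMono (lt_of_le_of_ne (Finset.mem_Ici.mp hk) hik)
  have hdvd : ∀ l, p l ^ a l ∣ n := fun l =>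
    h.eq_prod ▸ Finset.dvd_prod_of_mem (fun l => p l ^ a l) (Finset.mem_univ l)
  obtain ⟨m, hm⟩ : p i ^ j * p k ∣ n :=
    (((Nat.coprime_primes (h.prime i) hq).mpr hlt.ne).pow_left j).mul_dvd_of_dvd_of_dvd
      ((pow_dvd_pow _ hja).trans (hdvd i)) ((dvd_pow_self _ (h.exponent_pos k).ne').trans (hdvd k))
  obtain ⟨A, _, hA, v, x, hx, hc, hne1⟩ := exists_group_card_eq_pow_mul (h.prime i) hq hj hqj
  let e : ULift (A × Multiplicative (ZMod m)) ≃* A × Multiplicative (ZMod m) := MulEquiv.ulift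
  have hG := hall (ULift (A × Multiplicative (ZMod m))) (by
    rw [Nat.card_congr e.toEquiv, Nat.card_prod, hA, hm]
    exact congrArg _ (Nat.card_zmod m))
  let f : A →* ULift (A × Multiplicative (ZMod m)) :=
    e.symm.toMonoidHom.comp (MonoidHom.inl A _)
  have hf : Function.Injective f := e.symm.injective.comp (Prod.mk_left_injective 1)
  have := hG.conj_mul_inv_eq_one (h.prime i) hq hlt (v := f v) (x := f x)
    (by rw [← map_pow, hx, map_one])
    (by simp only [← map_mul, ← map_inv, ← map_pow, hc, map_one])
  apply hne1
  apply hf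
  simpa only [← map_mul, ← map_inv, map_one] using this
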